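/- Let $q$ be a prime power and $\mathbb{F}_q$ the finite field with $q$ elements. For a nonconstant polynomial $f(t)=\sum_{\ell=1}^R b_\ell t^{m_\ell}\in\mathbb{F}_q[t]$ with all $b_\ell\in\mathbb{F}_q^\times$ and pairwise distinct exponents $m_\ell\in\mathbb{Z}_{\ge 0}$, put $$\omega(f)=\min\Bigl\{\sum_{\ell=1}^R\gamma_\ell \;\Big|\; \gamma_1,\dots,\gamma_R\in\mathbb{Z},\ 0\le\gamma_1,\dots,\gamma_R\le q-1,\ \sum_{\ell=1}^R m_\ell\gamma_\ell\in(q-1)\mathbb{Z}^+\Bigr\},$$ where $\mathbb{Z}^+$ is the set of positive integers. For $I\subseteq\{1,\dots,n\}$ and a nonzero $P\in\mathbb{F}_q[t_1,\dots,t_n]$, let $\deg_I(P)$ be the maximum of $\sum_{i\in I}m_i$ over the monomials $a\,t_1^{m_1}\cdots t_n^{m_n}$ ($a\in\mathbb{F}_q^\times$) that occur in $P$. **Theorem.** Let $P_1,\dots,P_r\in\mathbb{F}_q[t_1,\dots,t_n]$ be nonzero polynomials, and let $I\subseteq\{1,\dots,n\}$ be a nonempty subset such that $\max_{1\le j\le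 r}\deg_I(P_j)>0$. Let $f_1,\dots,f_n\in\mathbb{F}_q[t]$, and assume that $f_i$ is nonconstant for all $i\in I$. Suppose that $$(q-1)\sum_{j=1}^r\deg_I(P_j)<\sum_{i\in I}\omega(f_i).$$ Then $$q^{\left\lceil\left(\sum_{i\in I}\frac{\omega(f_i)}{q-1}-\sum_{j=1}^r\deg_I(P_j)\right)\Big/\max_{1\le j\le r}\deg_I(P_j)\right\rceil}$$ divides $$\#\{(x_1,\dots,x_n)\in\mathbb{F}_q^n \mid P_j(f_1(x_1),\dots,f_n(x_n))=0\text{ for all }1\le j\le r\}.$$ -/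

import Mathlib

/-- The `I`-degree of a multivariate polynomial: the maximum, over the monomials
`a * t_1 ^ m_1 * ⋯ * t_n ^ m_n` (with `a ≠ 0`) of `P`, of `∑ i ∈ I, m_i`.
It is used for nonzero `P` only (the zero polynomial gets the value `0` here). -/
noncomputable def degOn {F : Type*} [Field F] {n : ℕ} (I : Finset (Fin n))
    (P : MvPolynomial (Fin n) F) : ℕ :=
  P.support.sup fun m => ∑ i ∈ I, m i

/-- The sums `∑ γ_ℓ` over all choices of one integer `0 ≤ γ_ℓ ≤ q - 1` for each exponent `m_ℓ`
that occurs in `f` (including the exponent `0` if the constant term is nonzero) such that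
`∑ m_ℓ * γ_ℓ` is a positive multiple of `q - 1`, where `q = #F`. The function `γ` is indexed by the
exponents themselves, and only its values on `f.support` matter. -/
def omegaSet {F : Type*} [Field F] [Fintype F] (f : Polynomial F) : Set ℕ :=
  {s | ∃ γ : ℕ → ℕ, (∀ m ∈ f.support, γ m ≤ Fintype.card F - 1) ∧
    (∃ k : ℕ, 0 < k ∧ ∑ m ∈ f.support, m * γ m = k * (Fintype.card F - 1)) ∧
    s = ∑ m ∈ f.support, γ m}

/-- The invariant `ω(f)`: the least element of `omegaSet f`. For nonconstant `f` that set is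
nonempty (see `card_sub_one_mem_omegaSet`), so this is a genuine minimum. -/
noncomputable def omega {F : Type*} [Field F] [Fintype F] (f : Polynomial F) : ℕ :=
  sInf (omegaSet f)

theorem card_sub_one_mem_omegaSet {F : Type*} [Field F] [Fintype F] (f : Polynomial F)
    (hf : 0 < f.natDegree) : Fintype.card F - 1 ∈ omegaSet f := by
  have hf0 : f ≠ 0 := by
    rintro rfl
    simp at hf
  have hmem : f.natDegree ∈ f.support := Polynomial.natDegree_mem_support_of_nonzero hf0
  refine ⟨fun m => if m = f.natDegree then Fintype.card F - 1 else 0, ?_,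
    ⟨f.natDegree, hf, ?_⟩, ?_⟩
  · intro m _
    dsimp only
    split_ifs <;> omega
  · simp only [mul_ite, mul_zero, Finset.sum_ite_eq', hmem, if_true]
  · simp only [Finset.sum_ite_eq', hmem, if_true]

/-! Write `q = p ^ a` and `Q_j = P_j(f_1(t_1), …, f_n(t_n))`. By orthogonality of an additive
character `ψ`, `q ^ r` times the number of solutions is the sum of `ψ (∑ y_j Q_j(x))` over all `x`,
`y`. The values are taken in the Witt vectors of `F` with a `p`-th root of unity `ζ` adjoined. There
`ψ` is a polynomial of degree at most `q - 1` in the Teichmüller lift, and Stickelberger's theorem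
makes its `k`-th coefficient divisible by `π = ζ - 1` to the digit sum of `k`
(`exists_stickelberger_expansion`).

Multiplying out over the monomials `b` of the `Q_j` gives a sum over weights `κ_b < q`
(`sum_sum_addChar_eq`). A term vanishes unless every power-sum exponent is divisible by `q - 1`; an
exponent `0` contributes a factor `q`. In a surviving term, each positive exponent attached to
`t_i`, `i ∈ I`, is a sum of exponents of `f_i`, so `ω(f_i)` bounds the number of summands from
below. Hence `∑ κ_b` is large (`card_sub_one_mul_le_of_dvd`).

Stickelberger needs digit sums rather than `∑ κ_b`. The bound therefore is applied to all `a` cyclic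
shifts of the digits of `κ` and added up (`pow_dvd_term`). Divisibility by a power of `p` finally
descends from the ring to the integers. -/

open Finset

/-! ### Power sums of the Teichmüller lift -/

/-- The power sums of a multiplicative map `T` on a finite field take the values they have for the
Teichmüller map. -/
def HasTeichmullerPowerSums {F R : Type*} [Field F] [Fintype F] [CommRing R] (T : F →* R) : Prop :=
  ∀ n : ℕ, ∑ x, T x ^ n =
    if n = 0 then (Fintype.card F : R)
    else if (Fintype.card F - 1) ∣ n then ((Fintype.card F - 1 : ℕ) : R) else 0

/-- If `q - 1 ∤ n`, some unit `u` has `u ^ n ≠ 1`. Since `T` is a section, `T u ^ n ≠ 1`, while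
scaling by `u` fixes the sum; a domain then forces the sum to be zero. -/
theorem hasTeichmullerPowerSums_of_section {F W : Type*} [Field F] [Fintype F] [CommRing W]
    [IsDomain W] (T : F →* W) (ρ : W →+* F) (hT0 : T 0 = 0) (hρ : ∀ x, ρ (T x) = x) :
    HasTeichmullerPowerSums T := by
  classical
  intro n
  split_ifs with h0 hd
  · simp [h0]
  · obtain ⟨k, rfl⟩ := hd
    have h : ∀ x : F, T x ^ ((Fintype.card F - 1) * k) = if x = 0 then 0 else 1 := by
      intro x
      split_ifs with hx
      · rw [hx, hT0, zero_pow h0]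
      · rw [← map_pow, pow_mul, FiniteField.pow_card_sub_one_eq_one x hx, one_pow, map_one]
    simp_rw [h]
    rw [Finset.sum_ite, Finset.sum_const_zero, zero_add, Finset.sum_const, nsmul_one,
      Finset.filter_not, Finset.filter_eq' univ (0 : F), if_pos (mem_univ _),
      Finset.card_sdiff_of_subset (by simp), Finset.card_univ, Finset.card_singleton]
  · obtain ⟨u, hu⟩ : ∃ u : Fˣ, u ^ n ≠ 1 := by
      by_contra! h
      exact hd ((FiniteField.forall_pow_eq_one_iff F n).1 h)
    have hmul : T u ^ n * ∑ x, T x ^ n = ∑ x, T x ^ n := by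
      rw [Finset.mul_sum]
      refine Fintype.sum_equiv (Equiv.mulLeft₀ (u : F) u.ne_zero) _ _ fun x => ?_
      simp [mul_pow]
    have hne : T u ^ n ≠ 1 := by
      intro h
      apply hu
      ext
      have := congrArg ρ h
      rwa [map_pow, hρ, map_one] at this
    have : (T u ^ n - 1) * ∑ x, T x ^ n = 0 := by rw [sub_mul, hmul, one_mul, sub_self]
    exact (mul_eq_zero.1 this).resolve_left (sub_ne_zero.2 hne)

theorem HasTeichmullerPowerSums.map {F W R : Type*} [Field F] [Fintype F] [CommRing W] [CommRing R]
    {T : F →* W} (h : HasTeichmullerPowerSums T) (φ : W →+* R) :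
    HasTeichmullerPowerSums ((φ : W →* R).comp T) := by
  intro n
  have := congrArg φ (h n)
  simp only [map_sum, map_pow] at this
  simp only [MonoidHom.coe_comp, Function.comp_apply, MonoidHom.coe_coe, this]
  split_ifs <;> simp

theorem HasTeichmullerPowerSums.eq_zero {F R : Type*} [Field F] [Fintype F] [CommRing R]
    {T : F →* R} (h : HasTeichmullerPowerSums T) {n : ℕ} (hn : 0 < n)
    (hd : ¬ (Fintype.card F - 1) ∣ n) : ∑ x, T x ^ n = 0 := by
  rw [h n, if_neg hn.ne', if_neg hd]

/-! ### Gauss sums, Jacobi sums and Stickelberger's divisibility -/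

/-- The Gauss sum of the `n`-th power of `T`, with the convention `0 ^ 0 = 1`. -/
def powGaussSum {F R : Type*} [Field F] [Fintype F] [CommRing R] (T : F →* R) (ψ : AddChar F R)
    (n : ℕ) : R := ∑ x, T x ^ n * ψ x

/-- Group the pairs by their sum `s`. For `s ≠ 0`, the substitution `x = s t` extracts `T s ^ (A +
B) = T s ^ C`. The fibre `s = 0` vanishes because `0 < C < q - 1` keeps `A + B` from being a
multiple of `q - 1`. -/
theorem powGaussSum_mul {F R : Type*} [Field F] [Fintype F] [CommRing R] {T : F →* R}
    (hT0 : T 0 = 0) (hT : HasTeichmullerPowerSums T) (ψ : AddChar F R) {A B C : ℕ} (hC : 0 < C)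
    (hAB : A + B = Fintype.card F - 1 + C) (hlt : C < Fintype.card F - 1) :
    powGaussSum T ψ A * powGaussSum T ψ B =
      (∑ t, T t ^ A * T (1 - t) ^ B) * powGaussSum T ψ C := by
  classical
  have hq : 0 < Fintype.card F - 1 := by lia
  have key : ∀ s : F, ∑ x, T x ^ A * T (s - x) ^ B =
      T s ^ C * ∑ t, T t ^ A * T (1 - t) ^ B := by
    intro s
    by_cases hs : s = 0
    · subst hs
      have h1 : ∀ x : F, T x ^ A * T (0 - x) ^ B = T (-1) ^ B * T x ^ (A + B) := by
        intro x
        rw [show (0 - x : F) = -1 * x by ring, map_mul, mul_pow, pow_add]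
        ring
      simp_rw [h1]
      rw [← Finset.mul_sum, hT.eq_zero (by lia), hT0, zero_pow hC.ne', mul_zero, zero_mul]
      intro hd
      rw [hAB, Nat.dvd_add_right dvd_rfl] at hd
      exact absurd (Nat.le_of_dvd hC hd) (by lia)
    · rw [Finset.mul_sum]
      refine (Fintype.sum_equiv (Equiv.mulLeft₀ s hs) _ _ fun t => ?_).symm
      have h1 : T s ^ C = T s ^ A * T s ^ B := by
        rw [← pow_add, hAB, pow_add, ← map_pow T s (Fintype.card F - 1),
          FiniteField.pow_card_sub_one_eq_one s hs, map_one, one_mul]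
      rw [h1, Equiv.mulLeft₀_apply, show s - s * t = s * (1 - t) by ring, map_mul, map_mul, mul_pow,
        mul_pow]
      ring
  calc powGaussSum T ψ A * powGaussSum T ψ B
      = ∑ x, ∑ s, T x ^ A * T (s - x) ^ B * ψ s := by
        rw [powGaussSum, powGaussSum, Finset.sum_mul_sum]
        refine Finset.sum_congr rfl fun x _ => ?_
        refine Fintype.sum_equiv (Equiv.addLeft x) _ _ fun y => ?_
        simp only [Equiv.coe_addLeft, add_sub_cancel_left, AddChar.map_add_eq_mul]
        ring
    _ = ∑ s, (∑ x, T x ^ A * T (s - x) ^ B) * ψ s := by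
        rw [Finset.sum_comm]
        simp_rw [Finset.sum_mul]
    _ = _ := by
        rw [powGaussSum, Finset.mul_sum]
        exact Finset.sum_congr rfl fun s _ => by rw [key s]; ring

/-- The Jacobi sum that relates the Gauss sums of index `k - 1` and `k` reduces to `-k`. -/
theorem sum_pow_mul_one_sub_pow {F : Type*} [Field F] [Fintype F] {k : ℕ} (hk : 2 ≤ k)
    (hlt : k < Fintype.card F - 1) :
    ∑ t : F, t ^ (Fintype.card F - 2) * (1 - t) ^ (Fintype.card F - k) = -(k : F) := by
  classical
  set q := Fintype.card F with hq
  have hT : HasTeichmullerPowerSums (MonoidHom.id F) :=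
    hasTeichmullerPowerSums_of_section _ (RingHom.id F) (by simp) (by simp)
  have hexp : ∀ t : F, t ^ (q - 2) * (1 - t) ^ (q - k) =
      ∑ j ∈ range (q - k + 1), (-1) ^ j * ((q - k).choose j : F) * t ^ (q - 2 + j) := by
    intro t
    rw [show (1 - t : F) = -t + 1 by ring, add_pow, Finset.mul_sum]
    refine Finset.sum_congr rfl fun j _ => ?_
    rw [one_pow, neg_pow, pow_add]
    ring
  simp_rw [hexp]
  rw [Finset.sum_comm]
  simp_rw [← Finset.mul_sum]
  -- The exponents `q - 2 + j` stay below `2 (q - 1)` because `k ≥ 2`, so only `j = 1` gives a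
  -- multiple of `q - 1`. Its value is `-(q - k) * (q - 1) = -k` in `F`.
  rw [Finset.sum_eq_single 1]
  · have h1 := hT (q - 2 + 1)
    simp only [MonoidHom.id_apply] at h1
    rw [h1, if_neg (by lia), ← hq, if_pos (by rw [show q - 2 + 1 = q - 1 by lia]),
      Nat.choose_one_right, Nat.cast_sub (by lia), Nat.cast_sub (by lia), hq,
      FiniteField.cast_card_eq_zero]
    simp
  · intro j hj hj1
    rw [Finset.mem_range] at hj
    have h1 := hT.eq_zero (n := q - 2 + j) (by lia)
    simp only [MonoidHom.id_apply] at h1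
    rw [h1, mul_zero]
    rintro ⟨c, hc⟩
    rw [← hq] at hc
    have hc2 : c < 2 := by
      by_contra! h
      have : (q - 1) * 2 ≤ (q - 1) * c := Nat.mul_le_mul_left _ h
      lia
    interval_cases c <;> lia
  · intro h
    exact absurd (Finset.mem_range.2 (by lia)) h

/-- The divisibility half of Stickelberger's theorem: `g_{q - 1 - k}` is divisible by `π` to the
power of the sum of the `p`-adic digits of `k`. -/
theorem exists_digits_dvd_powGaussSum {F R : Type*} [Field F] [Fintype F] [CommRing R] {p a : ℕ}
    (hp : p.Prime) [CharP F p] (hcard : Fintype.card F = p ^ a) {T : F →* R} (hT0 : T 0 = 0)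
    (hT : HasTeichmullerPowerSums T) {ψ : AddChar F R} (hfrob : ∀ x, ψ (x ^ p) = ψ x) {π : R}
    (hπ : ∀ x, π ∣ ψ x - 1)
    (hJ : ∀ A B : ℕ, ∑ t : F, t ^ A * (1 - t) ^ B ≠ 0 → IsUnit (∑ t, T t ^ A * T (1 - t) ^ B))
    (k : ℕ) (hk : 0 < k) (hkq : k < Fintype.card F - 1) :
    ∃ d : ℕ → ℕ, ∑ l ∈ range a, d l * p ^ l = k ∧
      π ^ (∑ l ∈ range a, d l) ∣ powGaussSum T ψ (Fintype.card F - 1 - k) := by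
  set q := Fintype.card F with hq
  obtain ⟨b, rfl⟩ : ∃ b, a = b + 1 := by
    refine Nat.exists_eq_succ_of_ne_zero fun h => ?_
    rw [h, pow_zero] at hcard
    lia
  have hone : π ∣ powGaussSum T ψ (q - 1 - 1) := by
    have h0 : ∑ x, T x ^ (q - 1 - 1) = 0 :=
      hT.eq_zero (by lia) fun h => absurd (Nat.le_of_dvd (by lia) h) (by lia)
    have : powGaussSum T ψ (q - 1 - 1) = ∑ x, T x ^ (q - 1 - 1) * (ψ x - 1) := by
      simp_rw [mul_sub, mul_one, Finset.sum_sub_distrib, h0, sub_zero, powGaussSum]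
    rw [this]
    exact Finset.dvd_sum fun x _ => Dvd.dvd.mul_left (hπ x) _
  induction k using Nat.strong_induction_on with
  | _ k ih =>
    by_cases hdvd : p ∣ k
    · obtain ⟨m, rfl⟩ := hdvd
      have hm : 0 < m := Nat.pos_of_mul_pos_left hk
      have hmlt : m < p * m := lt_mul_of_one_lt_left hm hp.one_lt
      obtain ⟨d, hd, hdd⟩ := ih m hmlt hm (by lia)
      -- Since `p * m < p ^ (b + 1)`, the top digit of `m` is zero, so multiplication by `p` just
      -- moves the digits up one place.
      have hdb : d b = 0 := by
        by_contra h
        have h1 : d b * p ^ b ≤ m := by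
          rw [← hd]
          exact Finset.single_le_sum (f := fun l => d l * p ^ l) (fun _ _ => Nat.zero_le _)
            (Finset.mem_range.2 (Nat.lt_succ_self b))
        have h2 : p ^ b ≤ m := (Nat.le_mul_of_pos_left _ (Nat.pos_of_ne_zero h)).trans h1
        have h3 : p ^ (b + 1) ≤ p * m := by
          rw [pow_succ, mul_comm]
          exact Nat.mul_le_mul_left _ h2
        lia
      refine ⟨fun l => if l = 0 then 0 else d (l - 1), ?_, ?_⟩
      · rw [Finset.sum_range_succ']
        simp only [Nat.add_eq_zero_iff, one_ne_zero, and_false, if_false, Nat.add_sub_cancel,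
          if_true, zero_mul, add_zero]
        rw [← hd, Finset.sum_range_succ, hdb, zero_mul, add_zero, Finset.mul_sum]
        exact Finset.sum_congr rfl fun l _ => by ring
      · rw [Finset.sum_range_succ']
        simp only [Nat.add_eq_zero_iff, one_ne_zero, and_false, if_false, Nat.add_sub_cancel,
          if_true, add_zero]
        rw [Finset.sum_range_succ, hdb, add_zero] at hdd
        convert hdd using 1
        have := ExpChar.prime (R := F) hp
        -- Reindexing by Frobenius, which fixes `ψ`, identifies the Gauss sums of index `q - 1 - m`
        -- and `q - 1 - p * m`.
        have hbij : Function.Bijective (frobenius F p) :=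
          Finite.injective_iff_bijective.1 (frobenius_inj F p)
        refine Fintype.sum_equiv (Equiv.ofBijective _ hbij) _ _ fun x => ?_
        rw [Equiv.ofBijective_apply, frobenius_def, hfrob, map_pow, ← pow_mul]
        congr 1
        by_cases hx : x = 0
        · rw [hx, hT0, zero_pow (by lia), zero_pow (Nat.mul_ne_zero hp.ne_zero (by lia))]
        · have h1 : p * (q - 1 - m) = (q - 1) * (p - 1) + (q - 1 - p * m) := by
            have hp1 := hp.one_lt
            zify [show 1 ≤ q by lia, show m ≤ q - 1 by lia, show p * m ≤ q - 1 by lia, hp1.le]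
            ring
          rw [h1, pow_add, pow_mul, ← map_pow T x (q - 1), FiniteField.pow_card_sub_one_eq_one x hx,
            map_one, one_pow, one_mul]
    · by_cases hk1 : k = 1
      · subst hk1
        refine ⟨fun l => if l = 0 then 1 else 0, ?_, ?_⟩
        · simp
        · simpa using hone
      · obtain ⟨d, hd, hdd⟩ := ih (k - 1) (by lia) (by lia) (by lia)
        refine ⟨fun l => if l = 0 then d 0 + 1 else d l, ?_, ?_⟩
        · rw [Finset.sum_range_succ'] at hd ⊢
          simp only [Nat.add_eq_zero_iff, one_ne_zero, and_false, if_false, if_true, pow_zero,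
            mul_one] at hd ⊢
          lia
        · rw [Finset.sum_range_succ'] at hdd ⊢
          simp only [Nat.add_eq_zero_iff, one_ne_zero, and_false, if_false, if_true] at hdd ⊢
          -- The indices `q - 2` and `q - k` belong to `1` and `k - 1`. Their Jacobi sum reduces to
          -- `-k ≠ 0`, hence is a unit, and the new factor `π` comes from the case `1`.
          have hunit := hJ (q - 2) (q - k) (by
            rw [sum_pow_mul_one_sub_pow (by lia) hkq, neg_ne_zero, Ne, CharP.cast_eq_zero_iff F p]
            exact hdvd)
          have hmul := powGaussSum_mul hT0 hT ψ (A := q - 2) (B := q - k) (C := q - 1 - k)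
            (by lia) (by lia) (by lia)
          rw [← hunit.dvd_mul_left, ← hmul, ← add_assoc, pow_succ, mul_comm]
          refine mul_dvd_mul hone ?_
          rwa [show q - k = q - 1 - (k - 1) by lia]

/-! ### Expansion of the additive character -/

/-- Fourier inversion on `Fˣ` gives the coefficients, the trivial one being `-1 / (q - 1)`. Matching
`ψ 0 = 1` forces `c 0 = 1`, so the rest, `-q / (q - 1)`, moves to `T x ^ (q - 1)`, which vanishes at
`0` and is `1` elsewhere. -/
theorem powGaussSum_expansion {F R : Type*} [Field F] [Fintype F] [CommRing R] {T : F →* R}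
    (hT0 : T 0 = 0) {ψ : AddChar F R} (hψ : ∑ x, ψ x = 0)
    (horth : ∀ z : F, z ≠ 0 → z ≠ 1 → ∑ k ∈ range (Fintype.card F - 1), T z ^ k = 0)
    (u : Rˣ) (hu : (u : R) = (Fintype.card F : R) - 1) (x : F) :
    ψ x = ∑ k ∈ range (Fintype.card F), (if k = 0 then 1 else if k = Fintype.card F - 1
      then -(Fintype.card F : R) * ↑u⁻¹
      else powGaussSum T ψ (Fintype.card F - 1 - k) * ↑u⁻¹) * T x ^ k := by
  classical
  obtain ⟨m, hm⟩ : ∃ m, Fintype.card F = m + 2 := by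
    obtain ⟨m, hm⟩ := Nat.exists_eq_add_of_le (Fintype.one_lt_card (α := F))
    exact ⟨m, by lia⟩
  by_cases hx : x = 0
  · subst hx
    rw [Finset.sum_eq_single 0]
    · simp
    · intro k _ hk
      rw [hT0, zero_pow hk, mul_zero]
    · intro h
      exact absurd (Finset.mem_range.2 (by lia)) h
  have hqx : T x ^ (m + 1) = 1 := by
    rw [← map_pow, show m + 1 = Fintype.card F - 1 by lia,
      FiniteField.pow_card_sub_one_eq_one x hx, map_one]
  have hS : powGaussSum T ψ (m + 1) = -1 := by
    have h1 : ∀ y : F, T y ^ (m + 1) * ψ y = ψ y - if y = 0 then 1 else 0 := by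
      intro y
      split_ifs with hy
      · simp [hy, hT0]
      · rw [← map_pow, show m + 1 = Fintype.card F - 1 by lia,
          FiniteField.pow_card_sub_one_eq_one y hy, map_one, one_mul, sub_zero]
    rw [powGaussSum]
    simp_rw [h1]
    simp [Finset.sum_sub_distrib, hψ]
  have hfourier : ∑ k ∈ range (m + 1), powGaussSum T ψ (m + 1 - k) * T x ^ k = u * ψ x := by
    simp_rw [powGaussSum, Finset.sum_mul]
    rw [Finset.sum_comm, Finset.sum_eq_single x]
    · rw [Finset.sum_congr rfl (g := fun _ => ψ x)]
      · rw [Finset.sum_const, Finset.card_range, nsmul_eq_mul, hu, hm]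
        push_cast
        ring
      · intro k hk
        rw [Finset.mem_range] at hk
        rw [mul_right_comm, ← pow_add, Nat.sub_add_cancel hk.le, hqx, one_mul]
    · intro y _ hyx
      by_cases hy : y = 0
      · refine Finset.sum_eq_zero fun k hk => ?_
        rw [Finset.mem_range] at hk
        rw [hy, hT0, zero_pow (by lia), zero_mul, zero_mul]
      · have h1 : ∀ k ∈ range (m + 1), T y ^ (m + 1 - k) * ψ y * T x ^ k =
            T y ^ (m + 1) * ψ y * T (x / y) ^ k := by
          intro k hk
          rw [Finset.mem_range] at hk
          have h2 : T x = T y * T (x / y) := by rw [← map_mul, mul_div_cancel₀ _ hy]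
          rw [h2, mul_pow]
          conv_rhs => rw [← Nat.sub_add_cancel hk.le, pow_add]
          ring
        rw [Finset.sum_congr rfl h1, ← Finset.mul_sum]
        have h3 := horth (x / y) (div_ne_zero hx hy) (fun h => hyx ((div_eq_one_iff_eq hy).1 h).symm)
        rw [hm, show m + 2 - 1 = m + 1 by lia] at h3
        rw [h3, mul_zero]
    · simp
  rw [Finset.sum_range_succ'] at hfourier
  rw [← u.isUnit.mul_right_inj, ← hfourier, hm, Finset.sum_range_succ _ (m + 1),
    Finset.sum_range_succ' _ m]
  have hmid : ∀ k ∈ range m, ((if k + 1 = 0 then 1 else if k + 1 = m + 2 - 1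
      then -((m + 2 : ℕ) : R) * ↑u⁻¹
      else powGaussSum T ψ (m + 2 - 1 - (k + 1)) * ↑u⁻¹) * T x ^ (k + 1)) =
      ↑u⁻¹ * (powGaussSum T ψ (m + 1 - (k + 1)) * T x ^ (k + 1)) := by
    intro k hk
    rw [Finset.mem_range] at hk
    rw [if_neg (by lia), if_neg (by lia), show m + 2 - 1 = m + 1 by lia]
    ring
  rw [Finset.sum_congr rfl hmid, ← Finset.mul_sum, if_pos rfl, if_neg (by lia), if_pos (by lia),
    hqx, tsub_zero, hS, pow_zero, mul_add, mul_add, Units.mul_inv_cancel_left]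
  have h4 : (u : R) * (-((m + 2 : ℕ) : R) * ↑u⁻¹ * 1) = -((m + 2 : ℕ) : R) := by
    rw [mul_one, mul_comm, mul_assoc, Units.inv_mul, mul_one]
  rw [h4, hu, hm]
  ring

/-! ### Powers of `ζ - 1` and divisibility by `p` -/

/-- The Eisenstein form `Φ_p(X + 1) = X ^ (p - 1) + p * H` has `H(0) = 1`; evaluate it at `ζ - 1`.
-/
theorem exists_pow_eq_neg_mul_of_geom_sum {R : Type*} [CommRing R] {p : ℕ} (hp : p.Prime) {ζ : R}
    (hζ : ∑ i ∈ range p, ζ ^ i = 0) : ∃ h : R, (ζ - 1) ^ (p - 1) = -(p * (1 + (ζ - 1) * h)) := by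
  have : Fact p.Prime := ⟨hp⟩
  have hp2 := hp.two_le
  have hE := cyclotomic_comp_X_add_one_isEisensteinAt p
  set G : Polynomial ℤ := (Polynomial.cyclotomic p ℤ).comp (Polynomial.X + 1) with hG
  have hmon : G.Monic := by
    rw [hG, ← Polynomial.C_1]
    exact (Polynomial.cyclotomic.monic p ℤ).comp_X_add_C 1
  have hdeg : G.natDegree = p - 1 := by
    rw [hG, Polynomial.natDegree_comp, ← Polynomial.C_1, Polynomial.natDegree_X_add_C, mul_one,
      Polynomial.natDegree_cyclotomic, Nat.totient_prime hp]
  have hdvd : Polynomial.C (p : ℤ) ∣ G - Polynomial.X ^ (p - 1) := by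
    rw [Polynomial.C_dvd_iff_dvd_coeff]
    intro i
    rw [Polynomial.coeff_sub, Polynomial.coeff_X_pow]
    rcases lt_trichotomy i (p - 1) with h | h | h
    · rw [if_neg h.ne, sub_zero]
      have := hE.mem (n := i) (by rw [hdeg]; exact h)
      exact Ideal.mem_span_singleton.1 this
    · rw [if_pos h, h, ← hdeg, hmon.coeff_natDegree]
      simp
    · rw [if_neg h.ne', Polynomial.coeff_eq_zero_of_natDegree_lt (by rw [hdeg]; exact h)]
      simp
  obtain ⟨H, hH⟩ := hdvd
  have hG0 : G.eval 0 = p := by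
    rw [hG, Polynomial.eval_comp]
    simp [Polynomial.eval_one_cyclotomic_prime]
  have hH0 : H.eval 0 = 1 := by
    have := congrArg (Polynomial.eval 0) hH
    rw [Polynomial.eval_sub, hG0, Polynomial.eval_mul, Polynomial.eval_C, Polynomial.eval_pow,
      Polynomial.eval_X, zero_pow (by lia), sub_zero] at this
    have hp0 : (p : ℤ) ≠ 0 := by exact_mod_cast hp.ne_zero
    exact (mul_left_cancel₀ hp0 (by rw [← this, mul_one])).symm
  obtain ⟨K, hK⟩ : Polynomial.X ∣ H - 1 := by
    rw [Polynomial.X_dvd_iff, Polynomial.coeff_zero_eq_eval_zero]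
    simp [hH0]
  refine ⟨Polynomial.aeval (ζ - 1) K, ?_⟩
  have hGz : Polynomial.aeval (ζ - 1) G = 0 := by
    rw [hG, Polynomial.aeval_comp, Polynomial.cyclotomic_prime]
    simpa using hζ
  have h1 := congrArg (Polynomial.aeval (ζ - 1)) hH
  have h2 := congrArg (Polynomial.aeval (ζ - 1)) hK
  simp only [map_sub, map_mul, map_pow, Polynomial.aeval_X, hGz, map_one, Polynomial.aeval_C] at h1 h2
  rw [← h2]
  simp only [zero_sub, algebraMap_int_eq, eq_intCast, Int.cast_natCast] at h1
  rw [add_sub_cancel, ← h1, neg_neg]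

theorem dvd_pow_sub_one_of_geom_sum {R : Type*} [CommRing R] {p : ℕ} (hp : p.Prime) {ζ : R}
    (hζ : ∑ i ∈ range p, ζ ^ i = 0) : (p : R) ∣ (ζ - 1) ^ (p - 1) := by
  obtain ⟨h, hh⟩ := exists_pow_eq_neg_mul_of_geom_sum hp hζ
  rw [hh, ← mul_neg]
  exact Dvd.intro _ rfl

/-- Instead of inverting `1 + (ζ - 1) * h`, substitute the relation for `p` into itself until the
remainder carries `(ζ - 1) ^ (p - 1)`. -/
theorem pow_sub_one_dvd_of_geom_sum {R : Type*} [CommRing R] {p : ℕ} (hp : p.Prime) {ζ : R}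
    (hζ : ∑ i ∈ range p, ζ ^ i = 0) : (ζ - 1) ^ (p - 1) ∣ (p : R) := by
  obtain ⟨h, hh⟩ := exists_pow_eq_neg_mul_of_geom_sum hp hζ
  have key : ∀ j : ℕ, ∃ s t : R, (p : R) = (ζ - 1) ^ (p - 1) * s + p * (ζ - 1) ^ j * t := by
    intro j
    induction j with
    | zero => exact ⟨0, 1, by simp⟩
    | succ j ih =>
      obtain ⟨s, t, hst⟩ := ih
      refine ⟨s - (ζ - 1) ^ j * t, -(h * t), ?_⟩
      linear_combination hst + (ζ - 1) ^ j * t * hh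
  obtain ⟨s, t, hst⟩ := key (p - 1)
  rw [hst]
  exact dvd_add (Dvd.intro _ rfl) (Dvd.dvd.mul_right (Dvd.intro_left _ rfl) _)

/-! ### The coefficient ring and the trace character -/

theorem geom_sum_map_eq_zero {F W : Type*} [Field F] [Fintype F] [CommRing W] [IsDomain W]
    (T : F →* W) (ρ : W →+* F) (hρ : ∀ x, ρ (T x) = x) (z : F) (hz : z ≠ 0) (hz1 : z ≠ 1) :
    ∑ k ∈ range (Fintype.card F - 1), T z ^ k = 0 := by
  have h := mul_geom_sum (T z) (Fintype.card F - 1)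
  rw [← map_pow, FiniteField.pow_card_sub_one_eq_one z hz, map_one, sub_self] at h
  refine (mul_eq_zero.1 h).resolve_left (sub_ne_zero.2 fun h1 => hz1 ?_)
  rw [← hρ z, h1, map_one]

/-- Cancel the exact power of `p` dividing `N`; one surplus factor `p` would make the cofactor
vanish under `ρ`. -/
theorem dvd_of_pow_dvd_of_residue {F W : Type*} [Field F] [CommRing W] [IsDomain W] [CharZero W]
    {p : ℕ} (hp : p.Prime) [CharP F p] (ρ : W →+* F) {L N : ℕ} (h : (p : W) ^ L ∣ (N : W)) :
    p ^ L ∣ N := by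
  by_cases hN : N = 0
  · simp [hN]
  obtain ⟨v, m, hm, rfl⟩ := Nat.exists_eq_pow_mul_and_not_dvd hN p hp.ne_one
  refine Dvd.dvd.mul_right (pow_dvd_pow p ?_) m
  by_contra! hlt
  obtain ⟨e, rfl⟩ := Nat.exists_eq_add_of_lt hlt
  obtain ⟨w, hw⟩ := h
  apply hm
  have hp0 : (p : W) ^ v ≠ 0 := pow_ne_zero _ (by exact_mod_cast hp.ne_zero)
  have h1 : (m : W) = p * (p ^ e * w) := by
    apply mul_left_cancel₀ hp0
    rw [← Nat.cast_pow, ← Nat.cast_mul, hw]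
    push_cast
    ring
  have h2 := congrArg ρ h1
  rw [map_natCast, map_mul, map_natCast, CharP.cast_eq_zero F p, zero_mul] at h2
  exact (CharP.cast_eq_zero_iff F p m).1 h2

/-- The ring obtained from `W` by adjoining a primitive `p`-th root of unity. -/
abbrev AdjoinZeta (p : ℕ) (W : Type*) [CommRing W] := AdjoinRoot (Polynomial.cyclotomic p W)

theorem AdjoinZeta.geom_sum_root {p : ℕ} (hp : p.Prime) (W : Type*) [CommRing W] :
    ∑ i ∈ range p, (AdjoinRoot.root (Polynomial.cyclotomic p W)) ^ i = 0 := by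
  have : Fact p.Prime := ⟨hp⟩
  have h := AdjoinRoot.mk_self (f := Polynomial.cyclotomic p W)
  have h1 : AdjoinRoot.mk (Polynomial.cyclotomic p W)
      (∑ i ∈ range p, (Polynomial.X : Polynomial W) ^ i) = 0 := by
    rwa [← Polynomial.cyclotomic_prime]
  simpa using h1

/-- The constant coefficient of the remainder modulo `Φ_p` serves. It brings divisibility of
integers by powers of `p` back to `W`, without `AdjoinZeta` having to be a domain. -/
theorem AdjoinZeta.exists_retraction {p : ℕ} (hp : p.Prime) (W : Type*) [CommRing W]
    [Nontrivial W] : ∃ φ : AdjoinZeta p W →ₗ[W] W, ∀ n : ℕ, φ (n : AdjoinZeta p W) = n := by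
  have hmon := Polynomial.cyclotomic.monic p W
  refine ⟨(Polynomial.lcoeff W 0).comp (AdjoinRoot.modByMonicHom hmon), fun n => ?_⟩
  have h1 : (n : AdjoinZeta p W) = AdjoinRoot.mk _ (Polynomial.C (n : W)) := by simp
  rw [h1, LinearMap.comp_apply, AdjoinRoot.modByMonicHom_mk,
    (Polynomial.modByMonic_eq_self_iff hmon).2]
  · simp
  · rw [Polynomial.degree_cyclotomic, Nat.totient_prime hp]
    refine Polynomial.degree_C_le.trans_lt ?_
    have := hp.two_le
    exact_mod_cast (by lia : 0 < p - 1)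

theorem AdjoinZeta.eq_zero_of_natCast_mul_eq_zero {p m : ℕ} (W : Type*) [CommRing W]
    [IsDomain W] [CharZero W] (hm : m ≠ 0) {s : AdjoinZeta p W} (h : (m : AdjoinZeta p W) * s = 0) :
    s = 0 := by
  have hmon := Polynomial.cyclotomic.monic p W
  have : Module.Free W (AdjoinZeta p W) := hmon.free_adjoinRoot
  have h1 : (m : W) • s = 0 := by rw [Algebra.smul_def, map_natCast, h]
  exact (smul_eq_zero.1 h1).resolve_left (by exact_mod_cast hm)

/-- The additive character `x ↦ ζ ^ Tr x`. -/
noncomputable def traceChar {F R : Type*} [Field F] [CommRing R] {p : ℕ} [Fact p.Prime]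
    [Algebra (ZMod p) F] {ζ : R} (hζ : ζ ^ p = 1) : AddChar F R :=
  (AddChar.zmodChar p hζ).compAddMonoidHom (Algebra.trace (ZMod p) F).toAddMonoidHom

theorem traceChar_apply {F R : Type*} [Field F] [CommRing R] {p : ℕ} [Fact p.Prime]
    [Algebra (ZMod p) F] {ζ : R} (hζ : ζ ^ p = 1) (x : F) :
    traceChar hζ x = ζ ^ (Algebra.trace (ZMod p) F x).val := rfl

theorem traceChar_pow {F R : Type*} [Field F] [Finite F] [CommRing R] {p : ℕ} [Fact p.Prime]
    [Algebra (ZMod p) F] {ζ : R} (hζ : ζ ^ p = 1) (x : F) :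
    traceChar hζ (x ^ p) = traceChar hζ x := by
  have h : Algebra.trace (ZMod p) F (x ^ p) = Algebra.trace (ZMod p) F x := by
    have := Algebra.trace_eq_of_algEquiv (FiniteField.frobeniusAlgEquivOfAlgebraic (ZMod p) F) x
    simpa using this
  rw [traceChar_apply, traceChar_apply, h]

theorem sub_one_dvd_traceChar_sub_one {F R : Type*} [Field F] [CommRing R] {p : ℕ} [Fact p.Prime]
    [Algebra (ZMod p) F] {ζ : R} (hζ : ζ ^ p = 1) (x : F) : ζ - 1 ∣ traceChar hζ x - 1 := by
  rw [traceChar_apply]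
  exact sub_one_dvd_pow_sub_one _ _

/-- Translation by `c * b`, with `b` of trace `1`, multiplies the sum by `ζ ^ c`. Summing over `c <
p` shows that `p` kills it, so only the absence of `p`-torsion is needed. -/
theorem sum_traceChar {F R : Type*} [Field F] [Fintype F] [CommRing R] {p : ℕ} [Fact p.Prime]
    [Algebra (ZMod p) F] {ζ : R} (hζ : ζ ^ p = 1) (hgeom : ∑ i ∈ range p, ζ ^ i = 0)
    (htf : ∀ s : R, (p : R) * s = 0 → s = 0) : ∑ x : F, traceChar hζ x = 0 := by
  obtain ⟨b, hb⟩ := Algebra.trace_surjective (ZMod p) F 1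
  have key : ∀ c : ℕ, ∑ x : F, traceChar hζ x = ζ ^ c * ∑ x : F, traceChar hζ x := by
    intro c
    have h1 : traceChar hζ ((c : F) * b) = ζ ^ c := by
      rw [traceChar, AddChar.compAddMonoidHom_apply, LinearMap.toAddMonoidHom_coe,
        ← nsmul_eq_mul, map_nsmul, hb, nsmul_one, AddChar.zmodChar_apply']
    rw [Finset.mul_sum]
    refine (Fintype.sum_equiv (Equiv.addLeft ((c : F) * b)) _ _ fun x => ?_).symm
    rw [Equiv.coe_addLeft, AddChar.map_add_eq_mul, h1]
  apply htf
  calc (p : R) * ∑ x : F, traceChar hζ x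
      = ∑ c ∈ range p, ζ ^ c * ∑ x : F, traceChar hζ x := by
        rw [Finset.sum_congr rfl fun c _ => (key c).symm]
        simp
    _ = 0 := by rw [← Finset.sum_mul, hgeom, zero_mul]

universe u

theorem exists_stickelberger_expansion_of_residue {F W : Type u} [Field F] [Fintype F]
    [DecidableEq F] [CommRing W] [IsDomain W] [CharZero W] {p a : ℕ} (hp : p.Prime) [CharP F p]
    (hcard : Fintype.card F = p ^ a) (τ : F →* W) (ρ : W →+* F) (hτ0 : τ 0 = 0)
    (hρ : ∀ x, ρ (τ x) = x) (hunit : ∀ w, ρ w ≠ 0 → IsUnit w) :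
    ∃ (R : Type u) (_ : CommRing R) (T : F →* R) (ψ : AddChar F R) (c : ℕ → R) (π : R),
      HasTeichmullerPowerSums T ∧
      (∀ x, ψ x = ∑ k ∈ range (Fintype.card F), c k * T x ^ k) ∧
      (∀ z, ∑ y, ψ (y * z) = if z = 0 then (Fintype.card F : R) else 0) ∧
      (∀ k < Fintype.card F, ∃ d : ℕ → ℕ, ∑ l ∈ range a, d l * p ^ l = k ∧
        π ^ (∑ l ∈ range a, d l) ∣ c k) ∧
      (p : R) ∣ π ^ (p - 1) ∧
      ∀ L N : ℕ, (p : R) ^ L ∣ (N : R) → p ^ L ∣ N := by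
  have : Fact p.Prime := ⟨hp⟩
  let : Algebra (ZMod p) F := ZMod.algebra F p
  let R := AdjoinZeta p W
  let φ : W →+* R := algebraMap W R
  let T : F →* R := (φ : W →* R).comp τ
  have hTφ : ∀ x, T x = φ (τ x) := fun _ => rfl
  have hT0 : T 0 = 0 := by rw [hTφ, hτ0, map_zero]
  have hT : HasTeichmullerPowerSums T :=
    (hasTeichmullerPowerSums_of_section τ ρ hτ0 hρ).map φ
  set ζ : R := AdjoinRoot.root (Polynomial.cyclotomic p W) with hζdef
  have hgeom : ∑ i ∈ range p, ζ ^ i = 0 := AdjoinZeta.geom_sum_root hp W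
  have hζ : ζ ^ p = 1 := by
    have := mul_geom_sum ζ p
    rw [hgeom, mul_zero] at this
    exact (sub_eq_zero.1 this.symm)
  have hψ : ∑ x : F, traceChar hζ x = 0 := sum_traceChar hζ hgeom fun s hs =>
    AdjoinZeta.eq_zero_of_natCast_mul_eq_zero W hp.ne_zero hs
  have horth : ∀ z : F, z ≠ 0 → z ≠ 1 → ∑ k ∈ range (Fintype.card F - 1), T z ^ k = 0 := by
    intro z hz hz1
    have := congrArg φ (geom_sum_map_eq_zero τ ρ hρ z hz hz1)
    rwa [map_sum, map_zero, Finset.sum_congr rfl fun k _ => map_pow φ (τ z) k] at this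
  have hu : IsUnit ((Fintype.card F : R) - 1) := by
    have h1 : IsUnit ((Fintype.card F : W) - 1) := by
      apply hunit
      rw [map_sub, map_natCast, FiniteField.cast_card_eq_zero, map_one]
      simp
    have h2 := h1.map φ
    rwa [map_sub, map_natCast, map_one] at h2
  obtain ⟨u, hu⟩ := hu
  have hJ : ∀ A B : ℕ, ∑ t : F, t ^ A * (1 - t) ^ B ≠ 0 →
      IsUnit (∑ t, T t ^ A * T (1 - t) ^ B) := by
    intro A B h
    have h1 : IsUnit (∑ t, τ t ^ A * τ (1 - t) ^ B) := by
      apply hunit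
      simpa only [map_sum, map_mul, map_pow, hρ] using h
    have h2 := h1.map φ
    rw [map_sum] at h2
    convert h2 using 2
    rw [map_mul, map_pow, map_pow, hTφ, hTφ]
  have hq1 := Fintype.one_lt_card (α := F)
  refine ⟨R, inferInstance, T, traceChar hζ, fun k => if k = 0 then 1
    else if k = Fintype.card F - 1 then -(Fintype.card F : R) * ↑u⁻¹
      else powGaussSum T (traceChar hζ) (Fintype.card F - 1 - k) * ↑u⁻¹, ζ - 1, hT,
    powGaussSum_expansion hT0 hψ horth u hu, ?_, ?_, dvd_pow_sub_one_of_geom_sum hp hgeom, ?_⟩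
  · intro z
    split_ifs with hz
    · simp [hz]
    · rw [← hψ]
      exact Fintype.sum_equiv (Equiv.mulRight₀ z hz) _ _ fun y => rfl
  · intro k hk
    rcases Nat.eq_zero_or_pos k with rfl | hk0
    · exact ⟨0, by simp, by simp⟩
    dsimp only
    rw [if_neg hk0.ne']
    by_cases hk1 : k = Fintype.card F - 1
    -- All digits of `q - 1` are `p - 1`, and `π ^ (a * (p - 1))` divides `p ^ a = q`.
    · refine ⟨fun _ => p - 1, ?_, ?_⟩
      · rw [hk1, hcard, ← Finset.mul_sum, Nat.geomSum_eq hp.two_le, Nat.mul_div_cancel']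
        exact Nat.sub_one_dvd_pow_sub_one p a
      · rw [if_pos hk1, Finset.sum_const, Finset.card_range, smul_eq_mul, mul_comm a, pow_mul,
          hcard, Nat.cast_pow]
        exact Dvd.dvd.mul_right
          ((pow_dvd_pow_of_dvd (pow_sub_one_dvd_of_geom_sum hp hgeom) a).neg_right) _
    · rw [if_neg hk1]
      obtain ⟨d, hd, hdd⟩ := exists_digits_dvd_powGaussSum hp hcard hT0 hT (traceChar_pow hζ)
        (sub_one_dvd_traceChar_sub_one hζ) hJ k hk0 (by lia)
      exact ⟨d, hd, hdd.mul_right _⟩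
  · rintro L N ⟨s, hs⟩
    obtain ⟨r, hr⟩ := AdjoinZeta.exists_retraction hp W
    refine dvd_of_pow_dvd_of_residue hp ρ ⟨r s, ?_⟩
    have h1 : (p : R) ^ L * s = (p : W) ^ L • s := by
      rw [Algebra.smul_def, map_pow, map_natCast]
    rw [← hr N, hs, h1, map_smul, smul_eq_mul]

theorem exists_stickelberger_expansion (F : Type u) [Field F] [Fintype F] [DecidableEq F] {p a : ℕ}
    (hp : p.Prime) [CharP F p] (hcard : Fintype.card F = p ^ a) :
    ∃ (R : Type u) (_ : CommRing R) (T : F →* R) (ψ : AddChar F R) (c : ℕ → R) (π : R),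
      HasTeichmullerPowerSums T ∧
      (∀ x, ψ x = ∑ k ∈ range (Fintype.card F), c k * T x ^ k) ∧
      (∀ z, ∑ y, ψ (y * z) = if z = 0 then (Fintype.card F : R) else 0) ∧
      (∀ k < Fintype.card F, ∃ d : ℕ → ℕ, ∑ l ∈ range a, d l * p ^ l = k ∧
        π ^ (∑ l ∈ range a, d l) ∣ c k) ∧
      (p : R) ∣ π ^ (p - 1) ∧
      ∀ L N : ℕ, (p : R) ^ L ∣ (N : R) → p ^ L ∣ N := by
  have : Fact p.Prime := ⟨hp⟩
  have : CharZero (WittVector p F) := by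
    refine (CharZero.charZero_iff_forall_prime_ne_zero _).2 fun l hl h => ?_
    have h1 := congrArg (WittVector.constantCoeff (p := p) (R := F)) h
    rw [map_natCast, map_zero, CharP.cast_eq_zero_iff F p] at h1
    rw [← (Nat.prime_dvd_prime_iff_eq hp hl).1 h1] at h
    exact WittVector.p_nonzero p F h
  exact exists_stickelberger_expansion_of_residue hp hcard (WittVector.teichmuller p)
    WittVector.constantCoeff (WittVector.teichmuller_zero p)
    (fun x => WittVector.teichmuller_coeff_zero p x)
    (fun w hw => WittVector.isUnit_of_coeff_zero_ne_zero w hw)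

/-! ### Sums of exponents and the invariant `ω` -/

/-- `N` is a sum of `d` exponents (with repetitions) that occur in `f`. -/
def IsExponentSum {F : Type*} [Field F] (f : Polynomial F) (d N : ℕ) : Prop :=
  ∃ s : ℕ → ℕ, ∑ m ∈ f.support, s m = d ∧ ∑ m ∈ f.support, m * s m = N

namespace IsExponentSum

variable {F : Type*} [Field F] {f : Polynomial F}

theorem zero : IsExponentSum f 0 0 := ⟨0, by simp, by simp⟩

theorem of_mem_support {m : ℕ} (hm : m ∈ f.support) : IsExponentSum f 1 m :=
  ⟨fun l => if l = m then 1 else 0, by rw [Finset.sum_ite_eq', if_pos hm],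
    by simp only [mul_ite, mul_one, mul_zero, Finset.sum_ite_eq', if_pos hm]⟩

theorem add {d d' N N' : ℕ} (h : IsExponentSum f d N) (h' : IsExponentSum f d' N') :
    IsExponentSum f (d + d') (N + N') := by
  obtain ⟨s, rfl, rfl⟩ := h
  obtain ⟨s', rfl, rfl⟩ := h'
  exact ⟨s + s', by simp [Finset.sum_add_distrib], by simp [mul_add, Finset.sum_add_distrib]⟩

theorem mul_left {d N : ℕ} (h : IsExponentSum f d N) (k : ℕ) : IsExponentSum f (k * d) (k * N) := by
  obtain ⟨s, rfl, rfl⟩ := h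
  refine ⟨fun m => k * s m, by rw [Finset.mul_sum], ?_⟩
  rw [Finset.mul_sum]
  exact Finset.sum_congr rfl fun m _ => by ring

theorem sum {ι : Type*} (t : Finset ι) {d N : ι → ℕ} (h : ∀ i ∈ t, IsExponentSum f (d i) (N i)) :
    IsExponentSum f (∑ i ∈ t, d i) (∑ i ∈ t, N i) := by
  classical
  induction t using Finset.induction_on with
  | empty => simpa using zero
  | insert a t ha ih =>
    rw [Finset.sum_insert ha, Finset.sum_insert ha]
    exact (h a (mem_insert_self a t)).add (ih fun i hi => h i (mem_insert_of_mem hi))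

theorem omega_le [Fintype F] {d N : ℕ} (h : IsExponentSum f d N) (hN : 0 < N)
    (hdvd : Fintype.card F - 1 ∣ N) : omega f ≤ d := by
  obtain ⟨s, rfl, rfl⟩ := h
  have hq : 0 < Fintype.card F - 1 := Nat.sub_pos_of_lt Fintype.one_lt_card
  set Q := Fintype.card F - 1 with hQ
  -- Positive multiplicities are reduced modulo `q - 1` to representatives in `1, …, q - 1`, not `0,
  -- …, q - 2`, so that the weighted sum stays positive.
  let γ : ℕ → ℕ := fun m => if s m = 0 then 0 else (s m - 1) % Q + 1
  have hγs : ∀ m, γ m ≤ s m := by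
    intro m
    by_cases h : s m = 0
    · simp [γ, h]
    · have := Nat.mod_le (s m - 1) Q
      simp only [γ, if_neg h]
      lia
  have hγQ : ∀ m, γ m ≤ Q := by
    intro m
    by_cases h : s m = 0
    · simp [γ, h]
    · simp only [γ, if_neg h]
      exact Nat.mod_lt _ hq
  have hγmod : ∀ m, γ m ≡ s m [MOD Q] := by
    intro m
    by_cases h : s m = 0
    · simp [γ, h, Nat.ModEq]
    · simp only [γ, if_neg h]
      have := (Nat.mod_modEq (s m - 1) Q).add_right 1
      rwa [Nat.sub_add_cancel (Nat.pos_of_ne_zero h)] at this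
  have hmod : ∑ m ∈ f.support, m * γ m ≡ ∑ m ∈ f.support, m * s m [MOD Q] := by
    apply Nat.ModEq.sum
    exact fun m _ => (hγmod m).mul_left m
  obtain ⟨k, hk⟩ := (Nat.ModEq.dvd_iff hmod dvd_rfl).2 hdvd
  suffices hpos : 0 < k by
    have hmem : ∑ m ∈ f.support, γ m ∈ omegaSet f :=
      ⟨γ, fun m _ => hγQ m, ⟨k, hpos, by rw [hk, mul_comm]⟩, rfl⟩
    exact (Nat.sInf_le hmem).trans (Finset.sum_le_sum fun m _ => hγs m)
  obtain ⟨m, hm, hms⟩ := Finset.exists_ne_zero_of_sum_ne_zero hN.ne'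
  refine Nat.pos_of_ne_zero fun h0 => ?_
  rw [h0, mul_zero, Finset.sum_eq_zero_iff] at hk
  have h1 := hk m hm
  rcases mul_eq_zero.1 h1 with h1 | h1
  · exact left_ne_zero_of_mul hms h1
  · simp [γ, right_ne_zero_of_mul hms] at h1

end IsExponentSum

theorem omega_le_card_sub_one {F : Type*} [Field F] [Fintype F] {f : Polynomial F}
    (hf : 0 < f.natDegree) : omega f ≤ Fintype.card F - 1 :=
  Nat.sInf_le (card_sub_one_mem_omegaSet f hf)

/-! ### Degrees counted in monomials of the `f i` -/

/-- Every monomial of `Q` is a product of at most `D` monomials of the polynomials `f i`, `i ∈ I`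
(and of monomials of the other `f i`). -/
def HasExponentDegreeLE {F : Type*} [Field F] {n : ℕ} (I : Finset (Fin n)) (f : Fin n → Polynomial F)
    (Q : MvPolynomial (Fin n) F) (D : ℕ) : Prop :=
  ∀ e ∈ Q.support, ∃ δ : Fin n → ℕ, (∀ i, IsExponentSum (f i) (δ i) (e i)) ∧ ∑ i ∈ I, δ i ≤ D

namespace HasExponentDegreeLE

variable {F : Type*} [Field F] {n : ℕ} {I : Finset (Fin n)} {f : Fin n → Polynomial F}

theorem C (a : F) : HasExponentDegreeLE I f (MvPolynomial.C a) 0 := by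
  classical
  intro e he
  have h0 : e = 0 := by
    rw [MvPolynomial.mem_support_iff, MvPolynomial.coeff_C] at he
    by_contra h
    exact he (if_neg (Ne.symm h))
  subst h0
  exact ⟨0, fun i => IsExponentSum.zero, by simp⟩

theorem mono {Q : MvPolynomial (Fin n) F} {D D' : ℕ} (h : HasExponentDegreeLE I f Q D)
    (hD : D ≤ D') : HasExponentDegreeLE I f Q D' := fun e he =>
  let ⟨δ, h1, h2⟩ := h e he
  ⟨δ, h1, h2.trans hD⟩

theorem mul {Q Q' : MvPolynomial (Fin n) F} {D D' : ℕ} (h : HasExponentDegreeLE I f Q D)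
    (h' : HasExponentDegreeLE I f Q' D') : HasExponentDegreeLE I f (Q * Q') (D + D') := by
  classical
  intro e he
  obtain ⟨u, hu, v, hv, rfl⟩ := Finset.mem_add.1 (MvPolynomial.support_mul Q Q' he)
  obtain ⟨δ, h1, h2⟩ := h u hu
  obtain ⟨δ', h1', h2'⟩ := h' v hv
  refine ⟨δ + δ', fun i => (h1 i).add (h1' i), ?_⟩
  simp only [Pi.add_apply, Finset.sum_add_distrib]
  exact add_le_add h2 h2'

theorem pow {Q : MvPolynomial (Fin n) F} {D : ℕ} (h : HasExponentDegreeLE I f Q D) (k : ℕ) :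
    HasExponentDegreeLE I f (Q ^ k) (k * D) := by
  induction k with
  | zero => simpa using C (1 : F)
  | succ k ih =>
    rw [pow_succ, Nat.succ_mul]
    exact ih.mul h

theorem prod {ι : Type*} (t : Finset ι) {Q : ι → MvPolynomial (Fin n) F} {D : ι → ℕ}
    (h : ∀ i ∈ t, HasExponentDegreeLE I f (Q i) (D i)) :
    HasExponentDegreeLE I f (∏ i ∈ t, Q i) (∑ i ∈ t, D i) := by
  classical
  induction t using Finset.induction_on with
  | empty => simpa using C (1 : F)
  | insert a t ha ih =>
    rw [Finset.sum_insert ha, Finset.prod_insert ha]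
    exact (h a (mem_insert_self a t)).mul (ih fun i hi => h i (mem_insert_of_mem hi))

theorem sum {ι : Type*} (t : Finset ι) {Q : ι → MvPolynomial (Fin n) F} {D : ℕ}
    (h : ∀ i ∈ t, HasExponentDegreeLE I f (Q i) D) :
    HasExponentDegreeLE I f (∑ i ∈ t, Q i) D := by
  classical
  intro e he
  obtain ⟨i, hi, hei⟩ := Finset.mem_biUnion.1 (MvPolynomial.support_sum he)
  exact h i hi e hei

theorem toMvPolynomial (i : Fin n) :
    HasExponentDegreeLE I f ((f i).toMvPolynomial i) (if i ∈ I then 1 else 0) := by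
  classical
  rw [Polynomial.toMvPolynomial, Polynomial.aeval_eq_sum_range'
    (Nat.lt_succ_self (f i).natDegree)]
  refine sum _ fun m _ e he => ?_
  rw [MvPolynomial.X_pow_eq_monomial, MvPolynomial.smul_monomial, smul_eq_mul, mul_one,
    MvPolynomial.support_monomial] at he
  split_ifs at he with h0
  · simp at he
  rw [Finset.mem_singleton] at he
  subst he
  refine ⟨fun l => if l = i then 1 else 0, fun l => ?_, ?_⟩
  · by_cases hl : l = i
    · subst hl
      simpa using IsExponentSum.of_mem_support (Polynomial.mem_support_iff.2 h0)
    · simpa [hl, Finsupp.single_apply, Ne.symm hl] using IsExponentSum.zero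
  · rw [Finset.sum_ite_eq']

theorem bind₁ (P : MvPolynomial (Fin n) F) :
    HasExponentDegreeLE I f (MvPolynomial.bind₁ (fun i => (f i).toMvPolynomial i) P)
      (degOn I P) := by
  classical
  rw [MvPolynomial.bind₁, MvPolynomial.aeval_def, MvPolynomial.eval₂_eq']
  refine sum _ fun m hm => ?_
  have h1 := (C (I := I) (f := f) (P.coeff m)).mul
    (prod univ fun i _ => (toMvPolynomial (I := I) (f := f) i).pow (m i))
  refine h1.mono ?_
  rw [zero_add]
  simp only [mul_ite, mul_one, mul_zero, Finset.sum_ite_mem, univ_inter]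
  exact Finset.le_sup (f := fun m : Fin n →₀ ℕ => ∑ i ∈ I, m i) hm

end HasExponentDegreeLE

/-! ### The weight estimate -/

/-- The estimate behind the divisibility: a system of weights `κ` on monomials for which all
the exponents that occur are divisible by `q - 1` has large total weight. -/
theorem card_sub_one_mul_le_of_dvd {F : Type*} [Field F] [Fintype F] {n r : ℕ}
    {I : Finset (Fin n)} {f : Fin n → Polynomial F} (hf : ∀ i ∈ I, 0 < (f i).natDegree)
    {α : Type*} [Fintype α] (j : α → Fin r) (δ e : α → Fin n → ℕ) (D : Fin r → ℕ) (Dm : ℕ)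
    (hδ : ∀ b i, IsExponentSum (f i) (δ b i) (e b i)) (hD : ∀ b, ∑ i ∈ I, δ b i ≤ D (j b))
    (hDm : 0 < Dm) (hDle : ∀ l, D l ≤ Dm) (κ : α → ℕ)
    (hκ : ∀ l, Fintype.card F - 1 ∣ ∑ b with j b = l, κ b)
    (hκe : ∀ i ∈ I, Fintype.card F - 1 ∣ ∑ b, κ b * e b i) :
    (Fintype.card F - 1) *
        (⌈((∑ i ∈ I, (omega (f i) : ℚ) / ((Fintype.card F : ℚ) - 1)) - ∑ l, (D l : ℚ)) / (Dm : ℚ)⌉₊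
          + r) ≤
      (Fintype.card F - 1) *
        (#{i ∈ I | ∑ b, κ b * e b i = 0} + #{l | ∑ b with j b = l, κ b = 0}) + ∑ b, κ b := by
  have hq : 0 < Fintype.card F - 1 := Nat.sub_pos_of_lt Fintype.one_lt_card
  have hcast : ((Fintype.card F : ℚ) - 1) = ((Fintype.card F - 1 : ℕ) : ℚ) := by
    rw [Nat.cast_sub Fintype.card_pos, Nat.cast_one]
  rw [hcast]
  set Q := Fintype.card F - 1 with hQ
  choose K hK using hκ
  have hsum : ∑ b, κ b = Q * ∑ l, K l := by
    rw [Finset.mul_sum, ← Finset.sum_fiberwise univ j κ]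
    exact Finset.sum_congr rfl fun l _ => hK l
  have hZ : #{l | ∑ b with j b = l, κ b = 0} = ∑ l, if K l = 0 then 1 else 0 := by
    rw [Finset.card_filter]
    refine Finset.sum_congr rfl fun l _ => ?_
    simp [hK, hq.ne']
  -- With truncated subtraction, `K l - 1` is `0` when `K l = 0`; the indicator makes up for the
  -- missing `1`.
  have hZK : (∑ l, if K l = 0 then 1 else 0) + ∑ l, K l = ∑ l, (K l - 1) + r := by
    have h1 : ∑ l, (K l - 1) + r = ∑ l, (K l - 1) + ∑ _l : Fin r, 1 := by simp
    rw [h1, ← Finset.sum_add_distrib, ← Finset.sum_add_distrib]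
    refine Finset.sum_congr rfl fun l _ => ?_
    split_ifs <;> lia
  rw [hsum, ← mul_add, hZ]
  set E := #{i ∈ I | ∑ b, κ b * e b i = 0} with hE
  set m := ∑ l, (K l - 1) with hm
  refine Nat.mul_le_mul_left _ ?_
  suffices h : ⌈((∑ i ∈ I, (omega (f i) : ℚ) / (Q : ℚ)) - ∑ l, (D l : ℚ)) / (Dm : ℚ)⌉₊ ≤ E + m by
    lia
  rw [Nat.ceil_le, div_le_iff₀ (by exact_mod_cast hDm), ← Finset.sum_div, sub_le_iff_le_add,
    div_le_iff₀ (by exact_mod_cast hq)]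
  suffices h : ∑ i ∈ I, omega (f i) ≤ ((E + m) * Dm + ∑ l, D l) * Q by exact_mod_cast h
  -- A zero total exponent costs `q - 1` by the trivial bound on `ω`; a positive one is a sum of `∑
  -- κ b * δ b i` exponents of `f i`.
  have h1 : ∑ i ∈ I, omega (f i) ≤ ∑ i ∈ I, ((if ∑ b, κ b * e b i = 0 then Q else 0) +
      ∑ b, κ b * δ b i) := by
    refine Finset.sum_le_sum fun i hi => ?_
    split_ifs with h0
    · exact (omega_le_card_sub_one (hf i hi)).trans (Nat.le_add_right _ _)
    · rw [zero_add]
      exact (IsExponentSum.sum univ fun b _ => (hδ b i).mul_left (κ b)).omega_le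
        (Nat.pos_of_ne_zero h0) (hκe i hi)
  have h2 : ∑ i ∈ I, ∑ b, κ b * δ b i ≤ ∑ l, D l * (Q * K l) := by
    rw [Finset.sum_comm]
    calc ∑ b, ∑ i ∈ I, κ b * δ b i ≤ ∑ b, κ b * D (j b) := by
          refine Finset.sum_le_sum fun b _ => ?_
          rw [← Finset.mul_sum]
          exact Nat.mul_le_mul_left _ (hD b)
      _ = ∑ l, D l * (Q * K l) := by
          rw [← Finset.sum_fiberwise univ j]
          refine Finset.sum_congr rfl fun l _ => ?_
          rw [← hK l, Finset.mul_sum]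
          refine Finset.sum_congr rfl fun b hb => ?_
          rw [(Finset.mem_filter.1 hb).2, mul_comm]
  have h3 : ∑ l, D l * (Q * K l) ≤ Q * (∑ l, D l + m * Dm) := by
    rw [hm, Finset.sum_mul, ← Finset.sum_add_distrib, Finset.mul_sum]
    refine Finset.sum_le_sum fun l _ => ?_
    rw [mul_left_comm]
    refine Nat.mul_le_mul_left _ ?_
    calc D l * K l ≤ D l * (1 + (K l - 1)) := Nat.mul_le_mul_left _ (by lia)
      _ = D l + (K l - 1) * D l := by ring
      _ ≤ _ := Nat.add_le_add_left (Nat.mul_le_mul_left _ (hDle l)) _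
  have h4 : ∑ i ∈ I, (if ∑ b, κ b * e b i = 0 then Q else 0) = E * Q := by
    rw [← Finset.sum_filter, Finset.sum_const, smul_eq_mul]
  rw [Finset.sum_add_distrib, h4] at h1
  calc ∑ i ∈ I, omega (f i) ≤ E * Q + Q * (∑ l, D l + m * Dm) :=
        h1.trans (Nat.add_le_add_left (h2.trans h3) _)
    _ ≤ E * Dm * Q + Q * (∑ l, D l + m * Dm) := by
        refine Nat.add_le_add_right (Nat.mul_le_mul_right _ (Nat.le_mul_of_pos_right _ hDm)) _
    _ = _ := by ring

/-! ### Cyclic shifts of digits -/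

theorem sum_range_add_mod {M : Type*} [AddCommMonoid M] (f : ℕ → M) (a l : ℕ) :
    ∑ i ∈ range a, f ((l + i) % a) = ∑ i ∈ range a, f i := by
  rcases Nat.eq_zero_or_pos a with rfl | ha
  · simp
  obtain ⟨b, rfl⟩ := Nat.exists_eq_succ_of_ne_zero ha.ne'
  induction l with
  | zero =>
    exact Finset.sum_congr rfl fun i hi => by
      rw [zero_add, Nat.mod_eq_of_lt (Finset.mem_range.1 hi)]
  | succ l ih =>
    rw [← ih, Finset.sum_range_succ, Finset.sum_range_succ' _ b]
    congr 1
    · exact Finset.sum_congr rfl fun i _ => by rw [add_assoc, add_comm 1 i]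
    · rw [show l + 1 + b = l + 0 + (b + 1) by ring, Nat.add_mod_right]

/-- The number obtained from the `p`-adic digits `d` by a cyclic shift by `i` places. -/
def cyclicShift (p a i : ℕ) (d : ℕ → ℕ) : ℕ := ∑ l ∈ range a, d l * p ^ ((l + i) % a)

/-- Wrapping around is free because `p ^ a ≡ 1`. -/
theorem cyclicShift_modEq {p a : ℕ} (hp : 0 < p) (i : ℕ) (d : ℕ → ℕ) :
    cyclicShift p a i d ≡ p ^ i * ∑ l ∈ range a, d l * p ^ l [MOD p ^ a - 1] := by
  rw [cyclicShift, Finset.mul_sum]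
  refine Nat.ModEq.sum fun l _ => ?_
  rw [mul_left_comm]
  refine Nat.ModEq.mul_left _ ?_
  have h1 : p ^ a ≡ 1 [MOD p ^ a - 1] :=
    ((Nat.modEq_iff_dvd' (Nat.one_le_pow _ _ hp)).2 dvd_rfl).symm
  have h2 := (h1.pow ((l + i) / a)).mul_right (p ^ ((l + i) % a))
  rw [← pow_mul, ← pow_add, Nat.div_add_mod, one_pow, one_mul, add_comm l i, pow_add] at h2
  rw [add_comm l i]
  exact h2.symm

theorem cyclicShift_eq_zero_iff {p a : ℕ} (hp : 0 < p) (i : ℕ) (d : ℕ → ℕ) :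
    cyclicShift p a i d = 0 ↔ ∑ l ∈ range a, d l * p ^ l = 0 := by
  simp [cyclicShift, Finset.sum_eq_zero_iff, hp.ne']

/-- Over all shifts each digit visits every place once, contributing `(p ^ a - 1) / (p - 1)` times
itself. -/
theorem sum_cyclicShift {p a : ℕ} (hp : 0 < p) (d : ℕ → ℕ) :
    (p - 1) * ∑ i ∈ range a, cyclicShift p a i d = (p ^ a - 1) * ∑ l ∈ range a, d l := by
  have h : (p - 1) * ∑ i ∈ range a, p ^ i = p ^ a - 1 := by
    have := geom_sum_mul_add (p - 1) a
    rw [show p - 1 + 1 = p by lia] at this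
    rw [← this, Nat.add_sub_cancel, mul_comm]
  simp_rw [cyclicShift]
  rw [Finset.sum_comm, ← h, mul_assoc]
  congr 1
  rw [Finset.mul_sum]
  refine Finset.sum_congr rfl fun l _ => ?_
  rw [← Finset.mul_sum, sum_range_add_mod, mul_comm]

/-! ### Character sums and the divisibility of their terms -/

theorem addChar_map_sum {A R ι : Type*} [AddCommMonoid A] [CommMonoid R] (ψ : AddChar A R)
    (s : Finset ι) (g : ι → A) : ψ (∑ i ∈ s, g i) = ∏ i ∈ s, ψ (g i) := by
  classical
  induction s using Finset.induction_on with
  | empty => simp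
  | insert i s hi ih => rw [Finset.sum_insert hi, Finset.prod_insert hi, ψ.map_add_eq_mul, ih]

/-- Expand `ψ` of each monomial and multiply out: `κ b` is the power of `T` chosen at `b`, after
which the sums over the coordinates separate. -/
theorem sum_sum_addChar_eq {F R : Type*} [Field F] [Fintype F] [DecidableEq F] [CommRing R]
    {T : F →* R} {ψ : AddChar F R} {c : ℕ → R}
    (hψ : ∀ x, ψ x = ∑ k ∈ range (Fintype.card F), c k * T x ^ k) {n r : ℕ} {α : Type*}
    [Fintype α] [DecidableEq α] (j : α → Fin r) (e : α → Fin n → ℕ) (A : α → F) :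
    ∑ x : Fin n → F, ∑ y : Fin r → F, ψ (∑ b, y (j b) * (A b * ∏ i, x i ^ e b i)) =
      ∑ κ ∈ Fintype.piFinset fun _ : α => range (Fintype.card F),
        (∏ b, c (κ b) * T (A b) ^ κ b) *
          ((∏ l, ∑ y, T y ^ ∑ b with j b = l, κ b) * ∏ i, ∑ x, T x ^ ∑ b, κ b * e b i) := by
  have hterm : ∀ (x : Fin n → F) (y : Fin r → F),
      ψ (∑ b, y (j b) * (A b * ∏ i, x i ^ e b i)) =
        ∑ κ ∈ Fintype.piFinset fun _ : α => range (Fintype.card F),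
          (∏ b, c (κ b) * T (A b) ^ κ b) *
            ((∏ l, T (y l) ^ ∑ b with j b = l, κ b) * ∏ i, T (x i) ^ ∑ b, κ b * e b i) := by
    intro x y
    rw [addChar_map_sum]
    simp_rw [hψ]
    rw [Finset.prod_univ_sum]
    refine Finset.sum_congr rfl fun κ _ => ?_
    have h1 : ∏ l, T (y l) ^ ∑ b with j b = l, κ b = ∏ b, T (y (j b)) ^ κ b := by
      rw [← Finset.prod_fiberwise univ j]
      refine Finset.prod_congr rfl fun l _ => ?_
      rw [← Finset.prod_pow_eq_pow_sum]
      exact Finset.prod_congr rfl fun b hb => by rw [(Finset.mem_filter.1 hb).2]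
    have h2 : ∏ i, T (x i) ^ ∑ b, κ b * e b i = ∏ b, ∏ i, T (x i) ^ (κ b * e b i) := by
      rw [Finset.prod_comm]
      exact Finset.prod_congr rfl fun i _ => (Finset.prod_pow_eq_pow_sum _ _ _).symm
    rw [h1, h2, ← Finset.prod_mul_distrib, ← Finset.prod_mul_distrib]
    refine Finset.prod_congr rfl fun b _ => ?_
    rw [map_mul, map_mul, map_prod, mul_pow, mul_pow, ← Finset.prod_pow]
    have h3 : ∀ i, T (x i ^ e b i) ^ κ b = T (x i) ^ (κ b * e b i) := fun i => by
      rw [map_pow, ← pow_mul, mul_comm]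
    simp_rw [h3]
    ring
  simp_rw [hterm]
  rw [Finset.sum_congr rfl fun x _ => Finset.sum_comm, Finset.sum_comm]
  refine Finset.sum_congr rfl fun κ _ => ?_
  rw [Finset.prod_univ_sum, Finset.prod_univ_sum, Fintype.piFinset_univ, Fintype.piFinset_univ,
    Finset.sum_mul_sum, Finset.sum_comm, Finset.mul_sum]
  exact Finset.sum_congr rfl fun y _ => by rw [Finset.mul_sum]

theorem sum_sum_addChar_eq_card {F R : Type*} [Field F] [Fintype F] [DecidableEq F] [CommRing R]
    {ψ : AddChar F R}
    (hψ : ∀ z, ∑ y, ψ (y * z) = if z = 0 then (Fintype.card F : R) else 0) {n r : ℕ}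
    (G : Fin r → (Fin n → F) → F) :
    ∑ x : Fin n → F, ∑ y : Fin r → F, ψ (∑ l, y l * G l x) =
      ((Fintype.card F ^ r * #{x | ∀ l, G l x = 0} : ℕ) : R) := by
  have h1 : ∀ x : Fin n → F, ∑ y : Fin r → F, ψ (∑ l, y l * G l x) =
      if ∀ l, G l x = 0 then (Fintype.card F : R) ^ r else 0 := by
    intro x
    simp_rw [addChar_map_sum]
    have h2 := Finset.prod_univ_sum (fun _ : Fin r => (univ : Finset F))
      (fun l y => ψ (y * G l x))
    rw [Fintype.piFinset_univ] at h2
    rw [← h2]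
    simp_rw [hψ]
    rw [Finset.prod_ite_zero]
    simp
  simp_rw [h1]
  rw [← Finset.sum_filter, Finset.sum_const, nsmul_eq_mul]
  push_cast
  ring

theorem pow_dvd_prod_sum_pow {F R : Type*} [Field F] [Fintype F] [CommRing R] {T : F →* R}
    (hT : HasTeichmullerPowerSums T) {ι : Type*} [Fintype ι] (s : Finset ι) (k : ι → ℕ) :
    (Fintype.card F : R) ^ #{i ∈ s | k i = 0} ∣ ∏ i, ∑ x, T x ^ k i := by
  classical
  have h1 : (Fintype.card F : R) ^ #{i ∈ s | k i = 0} =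
      ∏ i ∈ s with k i = 0, ∑ x, T x ^ k i := by
    rw [Finset.prod_congr rfl (g := fun _ => (Fintype.card F : R)), Finset.prod_const]
    intro i hi
    rw [hT, if_pos (Finset.mem_filter.1 hi).2]
  rw [h1]
  exact Finset.prod_dvd_prod_of_subset _ _ _ (Finset.subset_univ _)

theorem pow_dvd_term {F R : Type*} [Field F] [Fintype F] [CommRing R] {p a : ℕ} (hp : p.Prime)
    (hcard : Fintype.card F = p ^ a) {T : F →* R} (hT : HasTeichmullerPowerSums T) {c : ℕ → R}
    {π : R} (hc : ∀ k < Fintype.card F, ∃ d : ℕ → ℕ, ∑ l ∈ range a, d l * p ^ l = k ∧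
      π ^ (∑ l ∈ range a, d l) ∣ c k) (hπ : (p : R) ∣ π ^ (p - 1)) {n r : ℕ} (I : Finset (Fin n))
    {α : Type*} [Fintype α] (j : α → Fin r) (e : α → Fin n → ℕ) (w : α → R) (B : ℕ)
    (hbound : ∀ κ : α → ℕ, (∀ l, Fintype.card F - 1 ∣ ∑ b with j b = l, κ b) →
      (∀ i ∈ I, Fintype.card F - 1 ∣ ∑ b, κ b * e b i) →
      (Fintype.card F - 1) * B ≤ (Fintype.card F - 1) *
        (#{i ∈ I | ∑ b, κ b * e b i = 0} + #{l | ∑ b with j b = l, κ b = 0}) + ∑ b, κ b)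
    (κ : α → ℕ) (hκ : ∀ b, κ b < Fintype.card F) :
    (p : R) ^ (a * B) ∣ (∏ b, c (κ b) * w b) *
      ((∏ l, ∑ y, T y ^ ∑ b with j b = l, κ b) * ∏ i, ∑ x, T x ^ ∑ b, κ b * e b i) := by
  classical
  have hq : 0 < Fintype.card F - 1 := Nat.sub_pos_of_lt Fintype.one_lt_card
  by_cases h1 : ∀ l, Fintype.card F - 1 ∣ ∑ b with j b = l, κ b
  swap
  · push Not at h1
    obtain ⟨l, hl⟩ := h1
    rw [Finset.prod_eq_zero (mem_univ l) (hT.eq_zero (Nat.pos_of_ne_zero fun h => hl (by simp [h])) hl),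
      zero_mul, mul_zero]
    exact dvd_zero _
  by_cases h2 : ∀ i ∈ I, Fintype.card F - 1 ∣ ∑ b, κ b * e b i
  swap
  · push Not at h2
    obtain ⟨i, _, hi⟩ := h2
    rw [Finset.prod_eq_zero (mem_univ i) (hT.eq_zero (Nat.pos_of_ne_zero fun h => hi (by simp [h])) hi),
      mul_zero, mul_zero]
    exact dvd_zero _
  choose d hd hdd using fun b => hc (κ b) (hκ b)
  set Z := #{l | ∑ b with j b = l, κ b = 0} with hZ
  set E := #{i ∈ I | ∑ b, κ b * e b i = 0} with hE
  set S := ∑ b, ∑ l ∈ range a, d b l with hS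
  -- Shifting by `i` multiplies each `κ b` by `p ^ i` modulo `q - 1` and preserves its vanishing, so
  -- the divisibilities persist and `E`, `Z` do not change.
  have hshift : ∀ i, (Fintype.card F - 1) * B ≤
      (Fintype.card F - 1) * (E + Z) + ∑ b, cyclicShift p a i (d b) := by
    intro i
    have hmod : ∀ b, cyclicShift p a i (d b) ≡ p ^ i * κ b [MOD Fintype.card F - 1] := by
      intro b
      rw [hcard, ← hd b]
      exact cyclicShift_modEq hp.pos i (d b)
    have hzero : ∀ b, cyclicShift p a i (d b) = 0 ↔ κ b = 0 := by
      intro b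
      rw [← hd b]
      exact cyclicShift_eq_zero_iff hp.pos i (d b)
    have h3 := hbound (fun b => cyclicShift p a i (d b)) (fun l => ?_) fun l hl => ?_
    · simpa only [Finset.sum_eq_zero_iff, mul_eq_zero, hzero, hZ, hE] using h3
    · refine ((Nat.ModEq.sum fun b _ => hmod b).dvd_iff dvd_rfl).2 ?_
      rw [← Finset.mul_sum]
      exact (h1 l).mul_left _
    · refine ((Nat.ModEq.sum fun b _ => (hmod b).mul_right _).dvd_iff dvd_rfl).2 ?_
      simp_rw [mul_assoc]
      rw [← Finset.mul_sum]
      exact (h2 l hl).mul_left _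
  have hineq : (p - 1) * (a * B) ≤ (p - 1) * (a * (E + Z)) + S := by
    have h3 := Finset.sum_le_sum fun i (_ : i ∈ range a) => hshift i
    rw [Finset.sum_const, Finset.sum_add_distrib, Finset.sum_const, Finset.card_range,
      Finset.sum_comm] at h3
    have h4 : (p - 1) * ∑ b, ∑ i ∈ range a, cyclicShift p a i (d b) = (Fintype.card F - 1) * S := by
      rw [Finset.mul_sum, hS, Finset.mul_sum]
      exact Finset.sum_congr rfl fun b _ => by rw [sum_cyclicShift hp.pos, hcard]
    have h5 := Nat.mul_le_mul_left (p - 1) h3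
    rw [mul_add, h4] at h5
    simp only [smul_eq_mul] at h5
    refine Nat.le_of_mul_le_mul_left ?_ hq
    calc _ = (p - 1) * (a * ((Fintype.card F - 1) * B)) := by ring
      _ ≤ _ := h5
      _ = _ := by ring
  have hdvdc : π ^ S ∣ ∏ b, c (κ b) * w b := by
    rw [hS, ← Finset.prod_pow_eq_pow_sum]
    exact Finset.prod_dvd_prod_of_dvd _ _ fun b _ => (hdd b).mul_right _
  -- `t` is what the factors `q ^ (E + Z)` leave to be supplied by `π ^ S`; if the subtraction
  -- truncates, nothing is left.
  set t := a * B - a * (E + Z) with ht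
  have hpt : (p : R) ^ t ∣ π ^ S := by
    refine (pow_dvd_pow_of_dvd hπ t).trans ?_
    rw [← pow_mul]
    refine pow_dvd_pow _ ?_
    rw [ht, Nat.mul_sub]
    lia
  have hpq : (p : R) ^ (a * (E + Z)) = (Fintype.card F : R) ^ Z * (Fintype.card F : R) ^ E := by
    rw [hcard, Nat.cast_pow, ← pow_mul, ← pow_mul, ← pow_add]
    ring_nf
  refine (pow_dvd_pow _ (show a * B ≤ t + a * (E + Z) by lia)).trans ?_
  rw [pow_add, hpq]
  refine mul_dvd_mul (hpt.trans hdvdc) (mul_dvd_mul ?_ ?_)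
  · exact pow_dvd_prod_sum_pow hT univ _
  · exact pow_dvd_prod_sum_pow hT I _

/-! ### The divisibility theorem -/

theorem mainTheorem2 {F : Type*} [Field F] [Fintype F] (n r : ℕ)
    (P : Fin r → MvPolynomial (Fin n) F) (hP : ∀ j, P j ≠ 0)
    (I : Finset (Fin n)) (hI : I.Nonempty)
    (hmax : 0 < Finset.univ.sup fun j => degOn I (P j))
    (f : Fin n → Polynomial F) (hf : ∀ i ∈ I, 0 < (f i).natDegree)
    (hlow : (Fintype.card F - 1) * ∑ j, degOn I (P j) < ∑ i ∈ I, omega (f i)) :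
    Fintype.card F ^
        ⌈((∑ i ∈ I, (omega (f i) : ℚ) / ((Fintype.card F : ℚ) - 1))
            - ∑ j, (degOn I (P j) : ℚ))
          / ((Finset.univ.sup fun j => degOn I (P j) : ℕ) : ℚ)⌉₊ ∣
      Nat.card {x : Fin n → F //
        ∀ j, MvPolynomial.eval (fun i => (f i).eval (x i)) (P j) = 0} := by
  classical
  obtain ⟨p, hchar⟩ := CharP.exists F
  obtain ⟨a, hp, hcard⟩ : ∃ a : ℕ, p.Prime ∧ Fintype.card F = p ^ a :=
    let ⟨a, h⟩ := FiniteField.card F p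
    ⟨a, h⟩
  obtain ⟨R, _, T, ψ, c, π, hT, hψ, hψ0, hc, hπ, hdvd⟩ := exists_stickelberger_expansion F hp hcard
  let Q : Fin r → MvPolynomial (Fin n) F := fun j =>
    MvPolynomial.bind₁ (fun i => (f i).toMvPolynomial i) (P j)
  have hQ : ∀ j (x : Fin n → F), MvPolynomial.eval x (Q j) =
      MvPolynomial.eval (fun i => (f i).eval (x i)) (P j) := by
    intro j x
    have h := MvPolynomial.aeval_bind₁ x (fun i => (f i).toMvPolynomial i) (P j)
    simpa [MvPolynomial.aeval_eq_eval] using h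
  let α := Σ j : Fin r, (Q j).support
  let e : α → Fin n → ℕ := fun b => b.2.1
  have hdeg : ∀ b : α, ∃ δ : Fin n → ℕ, (∀ i, IsExponentSum (f i) (δ i) (e b i)) ∧
      ∑ i ∈ I, δ i ≤ degOn I (P b.1) := fun b => HasExponentDegreeLE.bind₁ (P b.1) b.2.1 b.2.2
  choose δ hδ hδle using hdeg
  have hbound := card_sub_one_mul_le_of_dvd hf (fun b : α => b.1) δ e (fun j => degOn I (P j))
    (Finset.univ.sup fun j => degOn I (P j)) hδ hδle hmax
    (fun j => Finset.le_sup (f := fun j => degOn I (P j)) (mem_univ j))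
  set M := ⌈((∑ i ∈ I, (omega (f i) : ℚ) / ((Fintype.card F : ℚ) - 1))
            - ∑ j, (degOn I (P j) : ℚ))
          / ((Finset.univ.sup fun j => degOn I (P j) : ℕ) : ℚ)⌉₊ with hM
  have hexp := sum_sum_addChar_eq hψ (fun b : α => b.1) e (fun b => (Q b.1).coeff b.2.1)
  have hsum : ∀ (x : Fin n → F) (y : Fin r → F),
      ∑ b : α, y b.1 * ((Q b.1).coeff b.2.1 * ∏ i, x i ^ e b i) =
        ∑ j, y j * MvPolynomial.eval x (Q j) := by
    intro x y
    rw [Fintype.sum_sigma]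
    refine Finset.sum_congr rfl fun j _ => ?_
    rw [MvPolynomial.eval_eq', Finset.mul_sum]
    exact Finset.sum_coe_sort (Q j).support
      fun m => y j * ((Q j).coeff m * ∏ i, x i ^ m i)
  simp_rw [hsum] at hexp
  rw [sum_sum_addChar_eq_card hψ0 fun j x => MvPolynomial.eval x (Q j)] at hexp
  have hdvdR : (p : R) ^ (a * (M + r)) ∣
      ((Fintype.card F ^ r * #{x | ∀ j, MvPolynomial.eval x (Q j) = 0} : ℕ) : R) := by
    rw [hexp]
    refine Finset.dvd_sum fun κ hκ => ?_
    exact pow_dvd_term hp hcard hT hc hπ I _ e _ _ hbound κ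
      fun b => Finset.mem_range.1 (Fintype.mem_piFinset.1 hκ b)
  have hdvdN := hdvd _ _ hdvdR
  -- Here `p ^ (a * (M + r)) = q ^ r * q ^ M`, and `q ^ r` cancels against the sum over `y`.
  rw [pow_mul, ← hcard, add_comm M r, pow_add] at hdvdN
  have hfin := Nat.dvd_of_mul_dvd_mul_left (pow_pos Fintype.card_pos r) hdvdN
  rw [Nat.card_eq_fintype_card, Fintype.card_subtype]
  simpa only [hQ] using hfin
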